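/- Let $\varrho=\varrho_{AB}$ be a state on $\mathbb C^d\otimes\mathbb C^d$ whose subsystem $A$ is maximally mixed, $\mathrm{Tr}_B\,\varrho = I/d$. Write $S(\sigma)=-\mathrm{Tr}\,\sigma\log_2\sigma$. *Protocol $\mathcal P$.* For an orthonormal basis $\{|i\rangle\}_{i=1}^d$ of $\mathbb C^d$, with $P_i=|i\rangle\langle i|$: (i) on each copy of $\varrho$, Alice performs the complete von Neumann measurement $\{P_i\}$; (ii) she rotates the basis $\{|i\rangle\}$ to the standard basis and sends her system to Bob through a classical channel (complete dephasing in the standard basis), and Bob undoes the rotation. Let $\varrho'_{AB}$ be the resulting state, all of which Bob holds; (iii) Bob extracts pure qubits from copies of $\varrho'_{AB}$ by noisy operations (adding a maximally mixed ancilla, a unitary of the total system, discarding a subsystem). The rate $r_{\mathcal P}^{\rightarrow}(\{P_i\})$ of the protocol with this measurement is the supremum of $\limsup_{n\to\infty} 2m_n/n$ over all sequences $(m_n)$ and noisy operations $\Lambda_n$ such that $\|\Lambda_n(\varrho_{AB}'^{\otimes n})-(|00\rangle\langle00|)^{\otimes m_n}\|_1\to0$, where $|00\rangle$ is a two-qubit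 state. The rate of the protocol is $r_{\mathcal P}^{\rightarrow}=\sup_{\{P_i\}} r_{\mathcal P}^{\rightarrow}(\{P_i\})$, over all orthonormal bases. Let $$p_i=\mathrm{Tr}\,[\varrho\,(P_i\otimes I)],\qquad \varrho_B^i=\frac1{p_i}\,\mathrm{Tr}_A[(P_i\otimes I)\,\varrho\,(P_i\otimes I)].$$ Then for every such measurement $$r_{\mathcal P}^{\rightarrow}(\{P_i\})=2\log_2 d-S(\varrho'_{AB})=\log_2 d-\sum_i p_i\,S(\varrho_B^i),$$ and hence $$r_{\mathcal P}^{\rightarrow}=\sup_{\{P_i\}}\Big(\log_2 d-\sum_i p_i\,S(\varrho_B^i)\Big),$$ and there is an optimal measurement, that is, an orthonormal basis with $r_{\mathcal P}^{\rightarrow}(\{P_i\})=r_{\mathcal P}^{\rightarrow}$. -/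

import Mathlib

open Filter Topology
open scoped Kronecker Matrix ComplexOrder

namespace LocalInfo

/-- A quantum state: a positive semidefinite matrix of unit trace. -/
structure IsState {ι : Type} [Fintype ι] (ρ : Matrix ι ι ℂ) : Prop where
  posSemidef : ρ.PosSemidef
  trace_eq_one : ρ.trace = 1

/-- Partial trace over the first tensor factor. -/
def traceFst {α β : Type} [Fintype α] (ρ : Matrix (α × β) (α × β) ℂ) : Matrix β β ℂ :=
  Matrix.of fun x y => ∑ i, ρ (i, x) (i, y)

/-- Partial trace over the second tensor factor. -/
def traceSnd {α β : Type} [Fintype β] (ρ : Matrix (α × β) (α × β) ℂ) : Matrix α α ℂ :=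
  Matrix.of fun i j => ∑ x, ρ (i, x) (j, x)

/-- The von Neumann entropy `S(ρ) = - Tr ρ log₂ ρ` in bits, computed from the eigenvalues
(`0 log 0 = 0`). It is only used for states; the value at a non-Hermitian matrix is irrelevant. -/
noncomputable def entropy {ι : Type} [Fintype ι] [DecidableEq ι] (ρ : Matrix ι ι ℂ) : ℝ :=
  open Classical in
  if h : ρ.IsHermitian then -∑ i, h.eigenvalues i * Real.logb 2 (h.eigenvalues i) else 0

/-- The trace norm `Tr √(Aᴴ A)`: the sum of the singular values of `A`. -/
noncomputable def traceNorm {ι : Type} [Fintype ι] [DecidableEq ι] (A : Matrix ι ι ℂ) : ℝ :=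
  ∑ i, Real.sqrt ((Matrix.isHermitian_conjTranspose_mul_self A).eigenvalues i)

/-- `n` independent copies `σ^{⊗ n}`. -/
def copies {ι : Type} (σ : Matrix ι ι ℂ) (n : ℕ) : Matrix (Fin n → ι) (Fin n → ι) ℂ :=
  Matrix.of fun x y => ∏ k, σ (x k) (y k)

/-! ### Noisy operations -/

/-- A noisy operation performed in one laboratory: add an ancilla in the maximally mixed state,
perform a unitary of the total system, discard a subsystem. The unitary identifies
`input ⊗ ancilla` with `output ⊗ discarded system`, so these have the same dimension. Every
composition of such steps is again of this form. -/
structure NoisyOperation (ι τ : Type) [Fintype ι] [DecidableEq ι] [Fintype τ] [DecidableEq τ] where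
  ancillaDim : ℕ
  ancillaDim_pos : 0 < ancillaDim
  discardDim : ℕ
  unitary : Matrix (τ × Fin discardDim) (ι × Fin ancillaDim) ℂ
  conjTranspose_mul_self : unitaryᴴ * unitary = 1
  self_mul_conjTranspose : unitary * unitaryᴴ = 1

/-- The action of a noisy operation on a matrix. -/
noncomputable def NoisyOperation.apply {ι τ : Type} [Fintype ι] [DecidableEq ι] [Fintype τ]
    [DecidableEq τ] (N : NoisyOperation ι τ) (σ : Matrix ι ι ℂ) : Matrix τ τ ℂ :=
  traceSnd (N.unitary *
    (σ ⊗ₖ ((N.ancillaDim : ℂ)⁻¹ • (1 : Matrix (Fin N.ancillaDim) (Fin N.ancillaDim) ℂ))) *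
    N.unitaryᴴ)

/-- `m` copies of the pure two-qubit pair `|0⟩|0⟩`, as the projector `(|00⟩⟨00|)^{⊗ m}`. -/
def purePairs (m : ℕ) : Matrix (Fin m → Fin 2 × Fin 2) (Fin m → Fin 2 × Fin 2) ℂ :=
  copies (Matrix.single (0, 0) (0, 0) 1) m

/-- The optimal rate at which the holder of the whole state `σ` extracts pure qubits from many
copies of `σ` by noisy operations. From `n` copies of `σ` one produces a state which
approximates, in trace norm and for large `n`, `m n` pairs `|0⟩|0⟩`; the rate is
`limsup 2 m n / n`, and the best rate over all such sequences of operations is taken. -/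
noncomputable def extractionRate {ι : Type} [Fintype ι] [DecidableEq ι] (σ : Matrix ι ι ℂ) :
    EReal :=
  sSup {R : EReal | ∃ (m : ℕ → ℕ)
      (N : ∀ n, NoisyOperation (Fin n → ι) (Fin (m n) → Fin 2 × Fin 2)),
    Tendsto (fun n => traceNorm ((N n).apply (copies σ n) - purePairs (m n))) atTop (𝓝 0) ∧
    R = limsup (fun n : ℕ => (((2 * (m n : ℝ)) / (n : ℝ) : ℝ) : EReal)) atTop}

/-! ### The one-way protocol -/

/-- An operator of Alice, acting on the joint system. -/
def onA {d : ℕ} (X : Matrix (Fin d) (Fin d) ℂ) : Matrix (Fin d × Fin d) (Fin d × Fin d) ℂ :=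
  X ⊗ₖ (1 : Matrix (Fin d) (Fin d) ℂ)

/-- A complete von Neumann measurement is given by an orthonormal basis `|i⟩`, the columns of a
unitary matrix `U`. These are its projectors `P_i = |i⟩⟨i|`. -/
def proj {d : ℕ} (U : Matrix.unitaryGroup (Fin d) ℂ) (i : Fin d) : Matrix (Fin d) (Fin d) ℂ :=
  Matrix.vecMulVec (fun a => U.1 a i) (fun a => star (U.1 a i))

/-- The probability `p_i = Tr (ρ (P_i ⊗ I))` of the outcome `i`. -/
noncomputable def prob {d : ℕ} (ρ : Matrix (Fin d × Fin d) (Fin d × Fin d) ℂ)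
    (U : Matrix.unitaryGroup (Fin d) ℂ) (i : Fin d) : ℝ :=
  (ρ * onA (proj U i)).trace.re

/-- Bob's state given the outcome `i`, `p_i⁻¹ Tr_A ((P_i ⊗ I) ρ (P_i ⊗ I))`. -/
noncomputable def bobState {d : ℕ} (ρ : Matrix (Fin d × Fin d) (Fin d × Fin d) ℂ)
    (U : Matrix.unitaryGroup (Fin d) ℂ) (i : Fin d) : Matrix (Fin d) (Fin d) ℂ :=
  ((prob ρ U i)⁻¹ : ℂ) • traceFst (onA (proj U i) * ρ * onA (proj U i))

/-- Alice's measurement, `ρ ↦ ∑ i, (P_i ⊗ I) ρ (P_i ⊗ I)`. -/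
def measureA {d : ℕ} (U : Matrix.unitaryGroup (Fin d) ℂ)
    (ρ : Matrix (Fin d × Fin d) (Fin d × Fin d) ℂ) : Matrix (Fin d × Fin d) (Fin d × Fin d) ℂ :=
  ∑ i, onA (proj U i) * ρ * onA (proj U i)

/-- The classical channel for Alice's system: complete dephasing in the standard basis. -/
def classicalChannel {d : ℕ} (ρ : Matrix (Fin d × Fin d) (Fin d × Fin d) ℂ) :
    Matrix (Fin d × Fin d) (Fin d × Fin d) ℂ :=
  ∑ k : Fin d, onA (Matrix.single k k 1) * ρ * onA (Matrix.single k k 1)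

/-- The state held by Bob at the end of Alice's part of the protocol. Alice measures in the basis
`|i⟩ = U e_i`, rotates this basis to the one preserved by the classical channel and sends her
system through the channel; Bob undoes the rotation. -/
def protocolState {d : ℕ} (ρ : Matrix (Fin d × Fin d) (Fin d × Fin d) ℂ)
    (U : Matrix.unitaryGroup (Fin d) ℂ) : Matrix (Fin d × Fin d) (Fin d × Fin d) ℂ :=
  onA U.1 * classicalChannel (onA U.1ᴴ * measureA U ρ * onA U.1) * onA U.1ᴴ

/-- The rate of the protocol when Alice measures in the basis `U`: Bob, who then holds copies of
the whole state `protocolState ρ U`, extracts pure qubits from them. -/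
noncomputable def protocolRateWith {d : ℕ} (ρ : Matrix (Fin d × Fin d) (Fin d × Fin d) ℂ)
    (U : Matrix.unitaryGroup (Fin d) ℂ) : EReal :=
  extractionRate (protocolState ρ U)

/-- The rate of the protocol, optimised over Alice's complete measurement. -/
noncomputable def protocolRate {d : ℕ} (ρ : Matrix (Fin d × Fin d) (Fin d × Fin d) ℂ) : EReal :=
  ⨆ U : Matrix.unitaryGroup (Fin d) ℂ, protocolRateWith ρ U

end LocalInfo

namespace LocalInfo

/-! ### Spectral preliminaries -/

/-! The rate formula is the extraction theorem `extractionRate_eq`, rate = log D - S for a state in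
dimension D, applied to Bob's final state. Both bounds rest on the weak law of large numbers for the
eigenvalue distribution of the state (`tendsto_sum_not_typical`): up to vanishing mass, the spectrum
of `n` copies sits on about 2^(nS) strings of weight about 2^(-nS).

Converse: the overlap of the output with the pure target is the expectation of a test with values in
[0, 1] and trace D^n / 4^m (`NoisyOperation.exists_test`). It therefore cannot exceed the atypical
mass plus 2^(n(log D - S + δ) - 2m). Achievability: when the typical strings number at most D^n /
4^m, a permutation of eigenvectors and ancilla states moves all of them into the block of the target
(`exists_noisyOperation`).

For Bob's state, the maximally mixed marginal makes every outcome have probability 1/d. In Alice's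
basis his state is thus a direct sum of the conditional states divided by d, and its entropy is log
d plus the average conditional entropy (`entropy_protocolState`). An optimal basis exists by
compactness of the unitary group (`exists_entropy_le`). -/

/-- The eigenvalues of a unitarily diagonalised Hermitian matrix are the diagonal entries. -/
lemma sum_eigenvalues_eq {ι : Type} [Fintype ι] [DecidableEq ι] {M V : Matrix ι ι ℂ} {a : ι → ℝ}
    (h : M.IsHermitian) (hV : Vᴴ * V = 1)
    (hM : M = V * Matrix.diagonal (fun i => (a i : ℂ)) * Vᴴ) (f : ℝ → ℝ) :
    ∑ i, f (h.eigenvalues i) = ∑ i, f (a i) := by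
  have h1 : M.charpoly = ∏ i, (Polynomial.X - Polynomial.C (a i : ℂ)) := by
    rw [hM, Matrix.charpoly_mul_comm, ← mul_assoc, hV, one_mul, Matrix.charpoly_diagonal]
  have h2 : M.charpoly.roots = Finset.univ.val.map (fun i => (a i : ℂ)) := by
    rw [h1, ← Polynomial.roots_multiset_prod_X_sub_C (Finset.univ.val.map fun i => (a i : ℂ)),
      Multiset.map_map]
    rfl
  rw [h.roots_charpoly_eq_eigenvalues] at h2
  -- The roots are complex; taking real parts inside the multiset returns to sums over real
  -- eigenvalues.
  have h3 := congrArg (fun s => (s.map (fun z : ℂ => f z.re)).sum) h2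
  simpa [Multiset.map_map, Function.comp_def] using h3

lemma entropy_eq {ι : Type} [Fintype ι] [DecidableEq ι] {M V : Matrix ι ι ℂ} {a : ι → ℝ}
    (hV : Vᴴ * V = 1) (hM : M = V * Matrix.diagonal (fun i => (a i : ℂ)) * Vᴴ) :
    entropy M = -∑ i, a i * Real.logb 2 (a i) := by
  have h : M.IsHermitian := by
    rw [hM, Matrix.IsHermitian, Matrix.conjTranspose_mul, Matrix.conjTranspose_mul,
      Matrix.diagonal_conjTranspose, Matrix.conjTranspose_conjTranspose, mul_assoc]
    congr 3
    ext i
    simp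
  rw [entropy, dif_pos h]
  congr 1
  exact sum_eigenvalues_eq h hV hM (fun x => x * Real.logb 2 x)

lemma exists_diagonalization {ι : Type} [Fintype ι] [DecidableEq ι] {M : Matrix ι ι ℂ}
    (h : M.IsHermitian) : ∃ V : Matrix ι ι ℂ, Vᴴ * V = 1 ∧ V * Vᴴ = 1 ∧
      M = V * Matrix.diagonal (fun i => (h.eigenvalues i : ℂ)) * Vᴴ := by
  refine ⟨h.eigenvectorUnitary, ?_, ?_, ?_⟩
  · rw [← Matrix.star_eq_conjTranspose]
    exact Unitary.coe_star_mul_self _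
  · rw [← Matrix.star_eq_conjTranspose]
    exact Unitary.coe_mul_star_self _
  · conv_lhs => rw [h.spectral_theorem, Unitary.conjStarAlgAut_apply]
    rfl

lemma IsState.exists_diagonalization {ι : Type} [Fintype ι] [DecidableEq ι] {M : Matrix ι ι ℂ}
    (h : IsState M) : ∃ (V : Matrix ι ι ℂ) (a : ι → ℝ), Vᴴ * V = 1 ∧ V * Vᴴ = 1 ∧
      M = V * Matrix.diagonal (fun i => (a i : ℂ)) * Vᴴ ∧ (∀ i, 0 ≤ a i) ∧ ∑ i, a i = 1 := by
  obtain ⟨V, hV, hV', hM⟩ := LocalInfo.exists_diagonalization h.posSemidef.isHermitian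
  refine ⟨V, _, hV, hV', hM, h.posSemidef.eigenvalues_nonneg, ?_⟩
  have h1 := h.posSemidef.isHermitian.trace_eq_sum_eigenvalues
  rw [h.trace_eq_one] at h1
  have h2 := congrArg Complex.re h1
  simpa using h2.symm

lemma traceNorm_diagonal {ι : Type} [Fintype ι] [DecidableEq ι] (a : ι → ℝ) :
    traceNorm (Matrix.diagonal fun i => (a i : ℂ)) = ∑ i, |a i| := by
  rw [traceNorm, sum_eigenvalues_eq (V := 1) (a := fun i => a i ^ 2)]
  · simp [Real.sqrt_sq_eq_abs]
  · simp
  · rw [Matrix.diagonal_conjTranspose, Matrix.diagonal_mul_diagonal]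
    simp [sq]

lemma traceNorm_nonneg {ι : Type} [Fintype ι] [DecidableEq ι] (A : Matrix ι ι ℂ) :
    0 ≤ traceNorm A :=
  Finset.sum_nonneg fun _ _ => Real.sqrt_nonneg _

/-- An entry is bounded by the Frobenius norm, and a sum of squared singular values by the square of
their sum. This lets the converse look at a single diagonal entry of the error. -/
lemma norm_apply_le_traceNorm {ι : Type} [Fintype ι] [DecidableEq ι] (A : Matrix ι ι ℂ) (i j : ι) :
    ‖A i j‖ ≤ traceNorm A := by
  refine le_of_sq_le_sq ?_ (traceNorm_nonneg A)
  have h1 : ‖A i j‖ ^ 2 ≤ ∑ k, ∑ l, ‖A l k‖ ^ 2 :=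
    (Finset.single_le_sum (f := fun l => ‖A l j‖ ^ 2) (fun _ _ => sq_nonneg _)
      (Finset.mem_univ i)).trans
    (Finset.single_le_sum (f := fun k => ∑ l, ‖A l k‖ ^ 2)
      (fun _ _ => Finset.sum_nonneg fun _ _ => sq_nonneg _) (Finset.mem_univ j))
  have h := Matrix.isHermitian_conjTranspose_mul_self A
  have h2 : ∑ k, ∑ l, ‖A l k‖ ^ 2 = ∑ k, h.eigenvalues k := by
    have := congrArg Complex.re h.trace_eq_sum_eigenvalues
    simp only [Matrix.trace, Matrix.diag, Matrix.mul_apply, Matrix.conjTranspose_apply,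
      Complex.re_sum] at this
    simpa [Complex.sq_norm, Complex.normSq_apply] using this
  have h3 : ∀ k, 0 ≤ h.eigenvalues k := (Matrix.posSemidef_conjTranspose_mul_self A).eigenvalues_nonneg
  calc _ ≤ ∑ k, Real.sqrt (h.eigenvalues k) ^ 2 := by
        rw [Finset.sum_congr rfl fun k _ => Real.sq_sqrt (h3 k), ← h2]
        exact h1
    _ ≤ _ := Finset.sum_sq_le_sq_sum_of_nonneg fun _ _ => Real.sqrt_nonneg _

/-! ### Tensor powers -/

lemma copies_mul {ι : Type} [Fintype ι] [DecidableEq ι] (A B : Matrix ι ι ℂ) (n : ℕ) :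
    copies (A * B) n = copies A n * copies B n := by
  ext x y
  simp only [copies, Matrix.of_apply, Matrix.mul_apply, Finset.prod_univ_sum,
    Fintype.piFinset_univ, Finset.prod_mul_distrib]

lemma copies_diagonal {ι : Type} [Fintype ι] [DecidableEq ι] (a : ι → ℂ) (n : ℕ) :
    copies (Matrix.diagonal a) n = Matrix.diagonal fun x => ∏ k, a (x k) := by
  ext x y
  by_cases h : x = y
  · subst h
    simp [copies]
  · obtain ⟨k, hk⟩ := Function.ne_iff.mp h
    rw [Matrix.diagonal_apply_ne _ h]
    exact Finset.prod_eq_zero (Finset.mem_univ k) (Matrix.diagonal_apply_ne _ hk)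

lemma copies_one {ι : Type} [Fintype ι] [DecidableEq ι] (n : ℕ) :
    copies (1 : Matrix ι ι ℂ) n = 1 := by
  rw [← Matrix.diagonal_one, copies_diagonal]
  simp

lemma copies_conjTranspose {ι : Type} (A : Matrix ι ι ℂ) (n : ℕ) :
    copies Aᴴ n = (copies A n)ᴴ := by
  ext x y
  simp [copies]

lemma purePairs_eq (m : ℕ) : purePairs m = Matrix.single 0 0 1 := by
  ext x y
  simp only [purePairs, copies, Matrix.of_apply, Matrix.single_apply]
  by_cases h : 0 = x ∧ 0 = y
  · obtain ⟨rfl, rfl⟩ := h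
    simp
  · rw [if_neg h, Finset.prod_eq_zero_iff]
    by_contra hc
    simp only [Finset.mem_univ, true_and, not_exists, ite_eq_right_iff, one_ne_zero, imp_false,
      not_not] at hc
    exact h ⟨funext fun k => (hc k).1, funext fun k => (hc k).2⟩

/-! ### The weak law of large numbers for finite product distributions -/

/-- The exponent keeps the form of the empirical sum that defines `typical` for surprisals, so
typicality bounds it directly. -/
lemma prod_eq_rpow {ι : Type} {q : ι → ℝ} {n : ℕ} {x : Fin n → ι}
    (hx : ∀ k, 0 < q (x k)) :
    ∏ k, q (x k) = (2 : ℝ) ^ (-∑ k, -Real.logb 2 (q (x k))) := by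
  rw [Finset.sum_neg_distrib, neg_neg, Real.rpow_sum_of_pos two_pos]
  exact Finset.prod_congr rfl fun k _ => (Real.rpow_logb two_pos (by norm_num) (hx k)).symm

section Typical

variable {ι : Type} [Fintype ι]

lemma sum_prod_eq_one {q : ι → ℝ} (hq : ∑ i, q i = 1) (n : ℕ) :
    ∑ x : Fin n → ι, ∏ k, q (x k) = 1 := by
  classical
  rw [← Fintype.piFinset_univ, ← Finset.prod_univ_sum]
  simp [hq]

lemma sum_cons {n : ℕ} (F : (Fin (n + 1) → ι) → ℝ) :
    ∑ x, F x = ∑ a : ι, ∑ x : Fin n → ι, F (Fin.cons a x) := by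
  rw [← Fintype.sum_prod_type', ← (Fin.consEquiv fun _ => ι).sum_comp]
  rfl

/-- The variance of a sum of independent centred variables is additive. -/
lemma sum_prod_mul_sum_sq {q g : ι → ℝ} (hq : ∑ i, q i = 1) (hg : ∑ i, q i * g i = 0) (n : ℕ) :
    ∑ x : Fin n → ι, (∏ k, q (x k)) * (∑ k, g (x k)) ^ 2 = n * ∑ i, q i * g i ^ 2 := by
  induction n with
  | zero => simp
  | succ n ih =>
    rw [sum_cons]
    simp only [Fin.prod_univ_succ, Fin.sum_univ_succ, Fin.cons_zero, Fin.cons_succ]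
    -- The square is expanded around the first coordinate; the cross term disappears after summing
    -- over `a`, because `g` is centred.
    have h : ∀ a, ∑ x : Fin n → ι, q a * (∏ k, q (x k)) * (g a + ∑ k, g (x k)) ^ 2 =
        q a * g a ^ 2 + 2 * (q a * g a) * (∑ x : Fin n → ι, (∏ k, q (x k)) * ∑ k, g (x k)) +
          q a * (n * ∑ i, q i * g i ^ 2) := by
      intro a
      rw [← ih, ← mul_one (q a * g a ^ 2), ← sum_prod_eq_one hq n, Finset.mul_sum, Finset.mul_sum,
        Finset.mul_sum, ← Finset.sum_add_distrib, ← Finset.sum_add_distrib]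
      exact Finset.sum_congr rfl fun x _ => by ring
    rw [Finset.sum_congr rfl fun a _ => h a, Finset.sum_add_distrib, Finset.sum_add_distrib,
      ← Finset.sum_mul, ← Finset.sum_mul, ← Finset.mul_sum, hg, hq]
    push_cast
    ring

/-- The strings for which the sum of `f` is within `n δ` of `n μ`. -/
noncomputable def typical (f : ι → ℝ) (μ δ : ℝ) (n : ℕ) : Finset (Fin n → ι) :=
  open Classical in {x | |∑ k, f (x k) - n * μ| < n * δ}

lemma mem_typical {f : ι → ℝ} {μ δ : ℝ} {n : ℕ} {x : Fin n → ι} :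
    x ∈ typical f μ δ n ↔ |∑ k, f (x k) - n * μ| < n * δ := by
  simp [typical]

/-- Chebyshev's inequality: the variance of the sum is `n * v`, so the atypical mass is at most v /
(δ² n). -/
lemma tendsto_sum_not_typical [DecidableEq ι] {q : ι → ℝ} (hq0 : ∀ i, 0 ≤ q i)
    (hq : ∑ i, q i = 1) (f : ι → ℝ) {μ : ℝ} (hμ : ∑ i, q i * f i = μ) {δ : ℝ} (hδ : 0 < δ) :
    Tendsto (fun n => ∑ x ∈ (typical f μ δ n)ᶜ, ∏ k, q (x k)) atTop (𝓝 0) := by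
  set v := ∑ i, q i * (f i - μ) ^ 2 with hv
  have hlim : Tendsto (fun n : ℕ => (v / δ ^ 2) / (n : ℝ)) atTop (𝓝 0) :=
    tendsto_const_div_atTop_nhds_zero_nat _
  refine squeeze_zero' (Eventually.of_forall fun n =>
    Finset.sum_nonneg fun x _ => Finset.prod_nonneg fun k _ => hq0 _) ?_ hlim
  filter_upwards [eventually_gt_atTop 0] with n hn
  have hn' : (0 : ℝ) < n := by exact_mod_cast hn
  have hvar := sum_prod_mul_sum_sq (g := fun i => f i - μ) hq (by
    simp only [mul_sub, Finset.sum_sub_distrib, ← Finset.sum_mul, hq, hμ]; ring) n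
  have h1 : (n * δ) ^ 2 * ∑ x ∈ (typical f μ δ n)ᶜ, ∏ k, q (x k) ≤ n * v := by
    rw [hv, ← hvar, Finset.mul_sum]
    refine (Finset.sum_le_sum fun x hx => ?_).trans (Finset.sum_le_sum_of_subset_of_nonneg
      (Finset.subset_univ (typical f μ δ n)ᶜ) fun x _ _ =>
        mul_nonneg (Finset.prod_nonneg fun k _ => hq0 _) (sq_nonneg _))
    rw [mul_comm]
    refine mul_le_mul_of_nonneg_left ?_ (Finset.prod_nonneg fun k _ => hq0 _)
    rw [Finset.mem_compl, mem_typical, not_lt] at hx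
    rw [Finset.sum_sub_distrib, Finset.sum_const, Finset.card_univ, Fintype.card_fin, nsmul_eq_mul,
      ← sq_abs (∑ k, f (x k) - n * μ)]
    exact pow_le_pow_left₀ (by positivity) hx 2
  rw [div_div, le_div_iff₀ (by positivity)]
  have h2 : n * ((∑ x ∈ (typical f μ δ n)ᶜ, ∏ k, q (x k)) * (δ ^ 2 * n)) ≤ n * v := by
    calc _ = (n * δ) ^ 2 * ∑ x ∈ (typical f μ δ n)ᶜ, ∏ k, q (x k) := by ring
      _ ≤ _ := h1
  exact le_of_mul_le_mul_left h2 hn'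

/-- A typical string has probability at most `2 ^ (-n (S - δ))`. -/
lemma prod_le_of_mem_typical {q : ι → ℝ} (hq0 : ∀ i, 0 ≤ q i) {S δ : ℝ} {n : ℕ} {x : Fin n → ι}
    (hx : x ∈ typical (fun i => -Real.logb 2 (q i)) S δ n) :
    ∏ k, q (x k) ≤ (2 : ℝ) ^ (-(n * (S - δ))) := by
  by_cases h : ∀ k, 0 < q (x k)
  · rw [prod_eq_rpow h]
    refine Real.rpow_le_rpow_of_exponent_le (by norm_num) ?_
    rw [mem_typical, abs_lt] at hx
    linarith [hx.1]
  -- Since `Real.logb 2 0 = 0`, a string with a letter of probability zero may count as typical, but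
  -- its product vanishes.
  · push Not at h
    obtain ⟨k, hk⟩ := h
    rw [Finset.prod_eq_zero (Finset.mem_univ k) (le_antisymm hk (hq0 _))]
    positivity

/-- There are at most `2 ^ (n (S + δ))` typical strings of positive probability. -/
lemma card_typical_le {q : ι → ℝ} (hq0 : ∀ i, 0 ≤ q i) (hq : ∑ i, q i = 1) {S δ : ℝ} {n : ℕ} :
    (((typical (fun i => -Real.logb 2 (q i)) S δ n).filter fun x => ∏ k, q (x k) ≠ 0).card : ℝ) ≤
      (2 : ℝ) ^ (n * (S + δ)) := by
  set T := (typical (fun i => -Real.logb 2 (q i)) S δ n).filter fun x => ∏ k, q (x k) ≠ 0 with hT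
  -- Each string in `T` has probability at least 2^(-n(S + δ)), and all probabilities sum to one.
  have h1 : T.card * (2 : ℝ) ^ (-(n * (S + δ))) ≤ 1 := by
    rw [← sum_prod_eq_one hq n, ← nsmul_eq_mul, ← Finset.sum_const]
    refine (Finset.sum_le_sum fun x hx => ?_).trans (Finset.sum_le_sum_of_subset_of_nonneg
      (Finset.subset_univ T) fun x _ _ => Finset.prod_nonneg fun k _ => hq0 _)
    rw [hT, Finset.mem_filter, mem_typical, abs_lt] at hx
    rw [prod_eq_rpow fun k => lt_of_le_of_ne (hq0 _)
      (Finset.prod_ne_zero_iff.mp hx.2 k (Finset.mem_univ k)).symm]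
    refine Real.rpow_le_rpow_of_exponent_le (by norm_num) ?_
    linarith [hx.1.2]
  rwa [Real.rpow_neg two_pos.le, ← div_eq_mul_inv, div_le_one (by positivity)] at h1

end Typical

/-! ### Noisy operations -/

section Noisy

variable {ι τ : Type} [Fintype ι] [DecidableEq ι] [Fintype τ] [DecidableEq τ]

/-- Cyclicity of the trace compares the two identity matrices, of sizes output × discarded and input
× ancilla. -/
lemma NoisyOperation.card_mul (N : NoisyOperation ι τ) :
    (Fintype.card τ : ℝ) * N.discardDim = Fintype.card ι * N.ancillaDim := by
  have h := Matrix.trace_mul_comm N.unitaryᴴ N.unitary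
  rw [N.conjTranspose_mul_self, N.self_mul_conjTranspose, Matrix.trace_one, Matrix.trace_one] at h
  simp only [Fintype.card_prod, Fintype.card_fin] at h
  exact_mod_cast h.symm

omit [Fintype ι] in
lemma kronecker_ancilla (a : ι → ℝ) (n : ℕ) :
    (Matrix.diagonal fun i => (a i : ℂ)) ⊗ₖ ((n : ℂ)⁻¹ • (1 : Matrix (Fin n) (Fin n) ℂ)) =
      Matrix.diagonal fun p : ι × Fin n => ((a p.1 * (n : ℝ)⁻¹ : ℝ) : ℂ) := by
  rw [← Matrix.diagonal_one, ← Matrix.diagonal_smul, Matrix.diagonal_kronecker_diagonal]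
  simp

/-- The eigenbasis of the input is absorbed into the unitary, leaving only the spectrum spread
uniformly over the ancilla. -/
lemma NoisyOperation.apply_conj (N : NoisyOperation ι τ) (V : Matrix ι ι ℂ) (a : ι → ℝ) :
    N.apply (V * Matrix.diagonal (fun i => (a i : ℂ)) * Vᴴ) =
      traceSnd ((N.unitary * (V ⊗ₖ (1 : Matrix (Fin N.ancillaDim) (Fin N.ancillaDim) ℂ))) *
        Matrix.diagonal (fun p : ι × Fin N.ancillaDim => ((a p.1 * (N.ancillaDim : ℝ)⁻¹ : ℝ) : ℂ)) *
        (N.unitary * (V ⊗ₖ (1 : Matrix (Fin N.ancillaDim) (Fin N.ancillaDim) ℂ)))ᴴ) := by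
  rw [NoisyOperation.apply, ← kronecker_ancilla, Matrix.conjTranspose_mul,
    Matrix.conjTranspose_kronecker, Matrix.conjTranspose_one]
  congr 1
  simp only [Matrix.mul_assoc]
  congr 1
  simp only [← Matrix.mul_assoc]
  congr 1
  rw [← Matrix.mul_kronecker_mul, ← Matrix.mul_kronecker_mul, one_mul, mul_one]

omit [Fintype ι] [DecidableEq ι] [Fintype τ] in
lemma sum_normSq_col {κ : Type} [Fintype κ] {W : Matrix κ τ ℂ} (h : Wᴴ * W = 1) (y : τ) :
    ∑ x, ‖W x y‖ ^ 2 = 1 := by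
  have := congrArg Complex.re (congrFun (congrFun h y) y)
  simpa [Matrix.mul_apply, Complex.sq_norm, Complex.normSq_apply] using this

/-- The overlap of the output of a noisy operation with a pure state, as the expectation of a test
of trace `card ι / card τ`. -/
lemma NoisyOperation.exists_test (N : NoisyOperation ι τ) {V : Matrix ι ι ℂ} (hV : Vᴴ * V = 1)
    (hV' : V * Vᴴ = 1) (t₀ : τ) :
    ∃ t : ι → ℝ, (∀ i, 0 ≤ t i) ∧ (∀ i, t i ≤ 1) ∧
      Fintype.card τ * ∑ i, t i = Fintype.card ι ∧
      ∀ a : ι → ℝ, N.apply (V * Matrix.diagonal (fun i => (a i : ℂ)) * Vᴴ) t₀ t₀ =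
        ((∑ i, t i * a i : ℝ) : ℂ) := by
  set W := N.unitary * (V ⊗ₖ (1 : Matrix (Fin N.ancillaDim) (Fin N.ancillaDim) ℂ)) with hW
  have hWW : Wᴴ * W = 1 := by
    rw [hW, Matrix.conjTranspose_mul, Matrix.mul_assoc, ← Matrix.mul_assoc N.unitaryᴴ,
      N.conjTranspose_mul_self, Matrix.one_mul, Matrix.conjTranspose_kronecker,
      ← Matrix.mul_kronecker_mul, hV, Matrix.conjTranspose_one, Matrix.one_mul,
      Matrix.one_kronecker_one]
  have hWW' : Wᴴᴴ * Wᴴ = 1 := by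
    rw [Matrix.conjTranspose_conjTranspose, hW, Matrix.conjTranspose_mul, Matrix.mul_assoc,
      ← Matrix.mul_assoc (V ⊗ₖ _), Matrix.conjTranspose_kronecker,
      ← Matrix.mul_kronecker_mul, hV', Matrix.conjTranspose_one, Matrix.one_mul,
      Matrix.one_kronecker_one, Matrix.one_mul, N.self_mul_conjTranspose]
  have hpos : (0 : ℝ) < N.ancillaDim := by exact_mod_cast N.ancillaDim_pos
  -- The test is the ancilla average of the weight of column `(i, k)` of `W` in the block of `t₀`.
  -- Normalised columns give the bound by one; the `discardDim` normalised rows of that block give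
  -- the trace.
  refine ⟨fun i => (N.ancillaDim : ℝ)⁻¹ * ∑ k, ∑ j, ‖W (t₀, j) (i, k)‖ ^ 2, fun i => by positivity,
    fun i => ?_, ?_, fun a => ?_⟩
  · rw [inv_mul_le_iff₀ hpos, mul_one]
    calc ∑ k, ∑ j, ‖W (t₀, j) (i, k)‖ ^ 2 ≤ ∑ _k : Fin N.ancillaDim, (1 : ℝ) := by
          refine Finset.sum_le_sum fun k _ => ?_
          rw [← sum_normSq_col hWW (i, k), Fintype.sum_prod_type]
          exact Finset.single_le_sum (f := fun t => ∑ j, ‖W (t, j) (i, k)‖ ^ 2)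
            (fun _ _ => by positivity) (Finset.mem_univ t₀)
      _ = _ := by simp
  · have h : ∑ i, ∑ k, ∑ j, ‖W (t₀, j) (i, k)‖ ^ 2 = N.discardDim := by
      rw [← Fintype.sum_prod_type' (f := fun i k => ∑ j, ‖W (t₀, j) (i, k)‖ ^ 2), Finset.sum_comm]
      have : ∀ j, ∑ p : ι × Fin N.ancillaDim, ‖W (t₀, j) (p.1, p.2)‖ ^ 2 = 1 := fun j => by
        have := sum_normSq_col hWW' (t₀, j)
        simpa using this
      simp [this]
    rw [← Finset.mul_sum, h, mul_left_comm, N.card_mul]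
    field_simp
  · rw [N.apply_conj, ← hW]
    simp only [traceSnd, Matrix.of_apply, Matrix.mul_apply (M := _ * _), Matrix.mul_diagonal,
      Matrix.conjTranspose_apply]
    rw [Finset.sum_comm, Fintype.sum_prod_type, Complex.ofReal_sum]
    refine Finset.sum_congr rfl fun i _ => ?_
    push_cast
    rw [Finset.mul_sum, Finset.sum_mul]
    refine Finset.sum_congr rfl fun k _ => ?_
    rw [Finset.mul_sum, Finset.sum_mul]
    refine Finset.sum_congr rfl fun j _ => ?_
    rw [← Complex.mul_conj', ← starRingEnd_apply]
    ring

/-- A set `T` of eigenvectors with `card T * card τ ≤ card ι` can be compressed by a noisy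
operation into a pure state of `τ`. -/
lemma exists_noisyOperation [Nonempty τ] {V : Matrix ι ι ℂ} (hV : Vᴴ * V = 1)
    (hV' : V * Vᴴ = 1) (t₀ : τ) {q : ι → ℝ} (hq0 : ∀ i, 0 ≤ q i) (hq : ∑ i, q i = 1)
    (T : Finset ι) (hT : T.card * Fintype.card τ ≤ Fintype.card ι) :
    ∃ N : NoisyOperation ι τ,
      traceNorm (N.apply (V * Matrix.diagonal (fun i => (q i : ℂ)) * Vᴴ) -
        Matrix.single t₀ t₀ 1) ≤ 2 * ∑ i ∈ Tᶜ, q i := by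
  -- With an ancilla of size `card τ` and a discarded system of size `card ι` the dimensions match.
  -- By `hT` the vectors over `T` inject into the block of `t₀`; the injection then extends to a
  -- bijection.
  obtain ⟨e, he⟩ : ∃ e : ι × Fin (Fintype.card τ) ≃ τ × Fin (Fintype.card ι),
      ∀ p, p.1 ∈ T → (e p).1 = t₀ := by
    have h1 : Fintype.card (T × Fin (Fintype.card τ)) ≤ Fintype.card (Fin (Fintype.card ι)) := by
      simpa using hT
    obtain ⟨g⟩ := Function.Embedding.nonempty_of_card_le h1
    have hcard : Fintype.card (ι × Fin (Fintype.card τ)) =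
        Fintype.card (τ × Fin (Fintype.card ι)) := by
      simp [mul_comm]
    let f : ι × Fin (Fintype.card τ) → τ × Fin (Fintype.card ι) := fun p =>
      if h : p.1 ∈ T then (t₀, g (⟨p.1, h⟩, p.2)) else (t₀, ⟨0, Fintype.card_pos_iff.mpr ⟨p.1⟩⟩)
    have hf : Set.InjOn f (T ×ˢ Finset.univ : Finset (ι × Fin (Fintype.card τ))) := by
      rintro ⟨x, k⟩ hx ⟨y, l⟩ hy hxy
      simp only [Finset.coe_product, Finset.coe_univ, Set.mem_prod, Finset.mem_coe, Set.mem_univ,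
        and_true] at hx hy
      simpa [f, hx, hy] using hxy
    obtain ⟨e, he⟩ := Finset.exists_equiv_extend_of_card_eq (hcard.trans Finset.card_univ.symm)
      (Finset.subset_univ _) hf
    refine ⟨e.trans (Equiv.subtypeUnivEquiv Finset.mem_univ), fun p hp => ?_⟩
    rw [Equiv.trans_apply, Equiv.subtypeUnivEquiv_apply, he p (by simp [hp])]
    simp [f, hp]
  -- Undo the eigenbasis, then permute basis vectors by `e`; the output becomes diagonal with
  -- entries `r`.
  set U : Matrix (τ × Fin (Fintype.card ι)) (ι × Fin (Fintype.card τ)) ℂ :=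
    (Vᴴ ⊗ₖ (1 : Matrix (Fin (Fintype.card τ)) (Fin (Fintype.card τ)) ℂ)).submatrix e.symm id with hU
  have hUU : Uᴴ * U = 1 := by
    rw [hU, Matrix.conjTranspose_submatrix, Matrix.submatrix_mul_equiv,
      Matrix.conjTranspose_kronecker, ← Matrix.mul_kronecker_mul, Matrix.conjTranspose_conjTranspose,
      hV', Matrix.conjTranspose_one, Matrix.one_mul, Matrix.one_kronecker_one, Matrix.submatrix_id_id]
  have hUU' : U * Uᴴ = 1 := by
    rw [hU, Matrix.conjTranspose_submatrix, ← Equiv.coe_refl, Matrix.submatrix_mul_equiv,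
      Matrix.conjTranspose_kronecker, ← Matrix.mul_kronecker_mul, Matrix.conjTranspose_conjTranspose,
      hV, Matrix.conjTranspose_one, Matrix.one_mul, Matrix.one_kronecker_one,
      Matrix.submatrix_one_equiv]
  let N : NoisyOperation ι τ := ⟨Fintype.card τ, Fintype.card_pos, Fintype.card ι, U, hUU, hUU'⟩
  refine ⟨N, ?_⟩
  set c : ℝ := (Fintype.card τ : ℝ)⁻¹ with hc
  set r : τ → ℝ := fun t => ∑ j, q (e.symm (t, j)).1 * c with hr
  have hr0 : ∀ t, 0 ≤ r t := fun t => Finset.sum_nonneg fun j _ => mul_nonneg (hq0 _) (by positivity)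
  have hsum : ∀ F : ι → ℝ, ∑ p : ι × Fin (Fintype.card τ), F p.1 * c = ∑ i, F i := fun F => by
    rw [Fintype.sum_prod_type]
    simp [hc, mul_left_comm]
  have hr1 : ∑ t, r t = 1 := by
    rw [hr, ← Fintype.sum_prod_type', e.symm.sum_comp (fun p => q p.1 * c), hsum, hq]
  have hUV : U * (V ⊗ₖ (1 : Matrix (Fin (Fintype.card τ)) (Fin (Fintype.card τ)) ℂ)) =
      (1 : Matrix (ι × Fin (Fintype.card τ)) (ι × Fin (Fintype.card τ)) ℂ).submatrix e.symm id := by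
    rw [hU, ← Matrix.submatrix_id_id (V ⊗ₖ _), ← Equiv.coe_refl, Matrix.submatrix_mul_equiv,
      ← Matrix.mul_kronecker_mul, hV, Matrix.one_mul, Matrix.one_kronecker_one]
  have happ : N.apply (V * Matrix.diagonal (fun i => (q i : ℂ)) * Vᴴ) =
      Matrix.diagonal fun t => (r t : ℂ) := by
    rw [N.apply_conj]
    change traceSnd ((U * (V ⊗ₖ (1 : Matrix (Fin (Fintype.card τ)) (Fin (Fintype.card τ)) ℂ))) *
        Matrix.diagonal (fun p : ι × Fin (Fintype.card τ) => ((q p.1 * c : ℝ) : ℂ)) *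
        (U * (V ⊗ₖ (1 : Matrix (Fin (Fintype.card τ)) (Fin (Fintype.card τ)) ℂ)))ᴴ) = _
    rw [hUV]
    have : (1 : Matrix (ι × Fin (Fintype.card τ)) (ι × Fin (Fintype.card τ)) ℂ).submatrix e.symm id *
        Matrix.diagonal (fun p : ι × Fin (Fintype.card τ) => ((q p.1 * c : ℝ) : ℂ)) *
        ((1 : Matrix (ι × Fin (Fintype.card τ)) (ι × Fin (Fintype.card τ)) ℂ).submatrix e.symm id)ᴴ =
        Matrix.diagonal fun s => ((q (e.symm s).1 * c : ℝ) : ℂ) := by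
      rw [← Matrix.submatrix_id_id (Matrix.diagonal fun p : ι × Fin (Fintype.card τ) =>
          ((q p.1 * c : ℝ) : ℂ)),
        ← Equiv.coe_refl, Matrix.submatrix_mul_equiv, Matrix.conjTranspose_submatrix,
        Matrix.submatrix_mul_equiv, Matrix.conjTranspose_one, Matrix.one_mul, Matrix.mul_one,
        Matrix.submatrix_diagonal_equiv]
      rfl
    rw [this]
    ext s t
    simp only [traceSnd, Matrix.of_apply, Matrix.diagonal_apply, Prod.mk.injEq, and_true]
    split_ifs
    · simp [hr]
    · simp
  have hdiff : N.apply (V * Matrix.diagonal (fun i => (q i : ℂ)) * Vᴴ) - Matrix.single t₀ t₀ 1 =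
      Matrix.diagonal fun t => ((r t - if t = t₀ then 1 else 0 : ℝ) : ℂ) := by
    rw [happ, ← Matrix.diagonal_single, Matrix.diagonal_sub]
    congr 1
    ext t
    by_cases h : t = t₀ <;> simp [h]
  -- Since `r` is a probability vector, the trace norm of the error is 2(1 - r t₀), and `r t₀` is at
  -- least the mass of `T`.
  rw [hdiff, traceNorm_diagonal, ← Finset.add_sum_erase _ _ (Finset.mem_univ t₀)]
  have h1 : ∑ t ∈ Finset.univ.erase t₀, |r t - if t = t₀ then 1 else 0| = 1 - r t₀ := by
    rw [← hr1, ← Finset.add_sum_erase _ _ (Finset.mem_univ t₀), add_sub_cancel_left]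
    exact Finset.sum_congr rfl fun t ht => by
      rw [if_neg (Finset.ne_of_mem_erase ht), sub_zero, abs_of_nonneg (hr0 t)]
  have h2 : ∑ i ∈ T, q i ≤ r t₀ := by
    have h3 : ∑ i ∈ T, q i = ∑ s, (if (e.symm s).1 ∈ T then q (e.symm s).1 else 0) * c := by
      rw [e.symm.sum_comp (fun p => (if p.1 ∈ T then q p.1 else 0) * c),
        hsum (fun i => if i ∈ T then q i else 0), Finset.sum_ite_mem, Finset.univ_inter]
    rw [h3, Fintype.sum_prod_type, Finset.sum_eq_single t₀]
    · refine Finset.sum_le_sum fun j _ => mul_le_mul_of_nonneg_right ?_ (by positivity)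
      split_ifs
      exacts [le_rfl, hq0 _]
    · intro t _ ht
      refine Finset.sum_eq_zero fun j _ => ?_
      rw [if_neg, zero_mul]
      intro hmem
      have := he _ hmem
      rw [e.apply_symm_apply] at this
      exact ht this
    · simp
  have h4 : r t₀ ≤ 1 := by
    rw [← hr1]
    exact Finset.single_le_sum (fun t _ => hr0 t) (Finset.mem_univ t₀)
  have h5 : ∑ i ∈ T, q i + ∑ i ∈ Tᶜ, q i = 1 := by rw [Finset.sum_add_sum_compl, hq]
  rw [h1, if_pos rfl, abs_of_nonpos (by linarith)]
  linarith

end Noisy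

/-! ### The optimal extraction rate -/

section Extraction

variable {ι : Type} [Fintype ι] [DecidableEq ι]

lemma copies_conj (V : Matrix ι ι ℂ) (a : ι → ℝ) (n : ℕ) :
    copies (V * Matrix.diagonal (fun i => (a i : ℂ)) * Vᴴ) n =
      copies V n * Matrix.diagonal (fun x => ((∏ k, a (x k) : ℝ) : ℂ)) * (copies V n)ᴴ := by
  rw [copies_mul, copies_mul, copies_diagonal, copies_conjTranspose]
  simp

lemma copies_isometry {V : Matrix ι ι ℂ} (hV : Vᴴ * V = 1) (n : ℕ) :
    (copies V n)ᴴ * copies V n = 1 := by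
  rw [← copies_conjTranspose, ← copies_mul, hV, copies_one]

lemma copies_isometry' {V : Matrix ι ι ℂ} (hV : V * Vᴴ = 1) (n : ℕ) :
    copies V n * (copies V n)ᴴ = 1 := by
  rw [← copies_conjTranspose, ← copies_mul, hV, copies_one]

/-- The error of any noisy operation which extracts `2 m` pure qubits from `n` copies. -/
lemma one_sub_traceNorm_le [Nonempty ι] {V : Matrix ι ι ℂ} (hV : Vᴴ * V = 1) (hV' : V * Vᴴ = 1)
    {a : ι → ℝ} (ha0 : ∀ i, 0 ≤ a i) (S δ : ℝ) {n m : ℕ}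
    (N : NoisyOperation (Fin n → ι) (Fin m → Fin 2 × Fin 2)) :
    1 - traceNorm (N.apply (copies (V * Matrix.diagonal (fun i => (a i : ℂ)) * Vᴴ) n) -
        purePairs m) ≤
      ∑ x ∈ (typical (fun i => -Real.logb 2 (a i)) S δ n)ᶜ, ∏ k, a (x k) +
        (2 : ℝ) ^ (n * (Real.logb 2 (Fintype.card ι) - S + δ) - 2 * m) := by
  obtain ⟨t, ht0, ht1, hts, ht⟩ :=
    N.exists_test (copies_isometry hV n) (copies_isometry' hV' n) 0
  set q : (Fin n → ι) → ℝ := fun x => ∏ k, a (x k) with hq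
  have hq0 : ∀ x, 0 ≤ q x := fun x => Finset.prod_nonneg fun k _ => ha0 _
  have hD : (0 : ℝ) < Fintype.card ι := by exact_mod_cast Fintype.card_pos
  -- The entry at the zero string is, up to sign, one minus the overlap with the target.
  have h1 := norm_apply_le_traceNorm (N.apply
    (copies (V * Matrix.diagonal (fun i => (a i : ℂ)) * Vᴴ) n) - purePairs m) 0 0
  rw [Matrix.sub_apply, purePairs_eq, Matrix.single_apply_same, copies_conj, ht q,
    ← Complex.ofReal_one, ← Complex.ofReal_sub, Complex.norm_real, Real.norm_eq_abs,
    abs_sub_comm, Complex.ofReal_one] at h1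
  rw [purePairs_eq, copies_conj]
  have h2 : 1 - ∑ x, t x * q x ≤ _ := (le_abs_self _).trans h1
  have h3 : ∑ x ∈ typical (fun i => -Real.logb 2 (a i)) S δ n, t x * q x ≤
      (2 : ℝ) ^ (n * (Real.logb 2 (Fintype.card ι) - S + δ) - 2 * m) := by
    have h4 : ∑ x, t x = (2 : ℝ) ^ (n * Real.logb 2 (Fintype.card ι) - 2 * m) := by
      rw [Real.rpow_sub two_pos, mul_comm (n : ℝ), Real.rpow_mul two_pos.le,
        Real.rpow_logb two_pos (by norm_num) hD, Real.rpow_natCast, Real.rpow_mul two_pos.le,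
        Real.rpow_natCast, eq_div_iff (by positivity), mul_comm]
      have : Fintype.card (Fin m → Fin 2 × Fin 2) = 4 ^ m := by simp
      rw [this] at hts
      have h5 : ((2 : ℝ) ^ (2 : ℝ)) = 4 := by norm_num
      rw [h5]
      simpa using hts
    calc _ ≤ ∑ x ∈ typical (fun i => -Real.logb 2 (a i)) S δ n, t x * (2 : ℝ) ^ (-(n * (S - δ))) :=
          Finset.sum_le_sum fun x hx =>
            mul_le_mul_of_nonneg_left (prod_le_of_mem_typical ha0 hx) (ht0 x)
      _ ≤ (∑ x, t x) * (2 : ℝ) ^ (-(n * (S - δ))) := by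
          rw [← Finset.sum_mul]
          refine mul_le_mul_of_nonneg_right ?_ (by positivity)
          exact Finset.sum_le_sum_of_subset_of_nonneg (Finset.subset_univ _) fun x _ _ => ht0 x
      _ = _ := by
          rw [h4, ← Real.rpow_add two_pos]
          congr 1
          ring
  have h6 : ∑ x ∈ (typical (fun i => -Real.logb 2 (a i)) S δ n)ᶜ, t x * q x ≤
      ∑ x ∈ (typical (fun i => -Real.logb 2 (a i)) S δ n)ᶜ, q x :=
    Finset.sum_le_sum fun x _ => mul_le_of_le_one_left (hq0 x) (ht1 x)
  have h7 := Finset.sum_add_sum_compl (typical (fun i => -Real.logb 2 (a i)) S δ n)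
    fun x => t x * q x
  linarith

/-- From `n` copies one extracts `2 m` pure qubits, with an error governed by the atypical strings,
as soon as `2 m ≤ n (log D - S - δ)`. -/
lemma exists_extraction [Nonempty ι] {V : Matrix ι ι ℂ} (hV : Vᴴ * V = 1) (hV' : V * Vᴴ = 1)
    {a : ι → ℝ} (ha0 : ∀ i, 0 ≤ a i) (ha : ∑ i, a i = 1) (S δ : ℝ) {n m : ℕ}
    (hm : m = 0 ∨ 2 * (m : ℝ) ≤ n * (Real.logb 2 (Fintype.card ι) - S - δ)) :
    ∃ N : NoisyOperation (Fin n → ι) (Fin m → Fin 2 × Fin 2),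
      traceNorm (N.apply (copies (V * Matrix.diagonal (fun i => (a i : ℂ)) * Vᴴ) n) -
          purePairs m) ≤
        2 * ∑ x ∈ (typical (fun i => -Real.logb 2 (a i)) S δ n)ᶜ, ∏ k, a (x k) := by
  have hD : (0 : ℝ) < Fintype.card ι := by exact_mod_cast Fintype.card_pos
  set T := (typical (fun i => -Real.logb 2 (a i)) S δ n).filter fun x => ∏ k, a (x k) ≠ 0 with hT
  have hcard : T.card * Fintype.card (Fin m → Fin 2 × Fin 2) ≤ Fintype.card (Fin n → ι) := by
    have h4 : Fintype.card (Fin m → Fin 2 × Fin 2) = 4 ^ m := by simp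
    rcases hm with rfl | hm
    · simpa using T.card_le_univ
    · rw [h4]
      have h1 : (T.card : ℝ) ≤ (2 : ℝ) ^ (n * (S + δ)) := card_typical_le ha0 ha
      have h2 : (4 : ℝ) ^ m ≤ (2 : ℝ) ^ (n * (Real.logb 2 (Fintype.card ι) - S - δ)) := by
        calc (4 : ℝ) ^ m = (2 : ℝ) ^ (2 * (m : ℝ)) := by
              rw [Real.rpow_mul two_pos.le, Real.rpow_natCast]
              norm_num
          _ ≤ _ := Real.rpow_le_rpow_of_exponent_le (by norm_num) hm
      have h3 : (T.card : ℝ) * 4 ^ m ≤ (Fintype.card ι : ℝ) ^ n := by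
        refine (mul_le_mul h1 h2 (by positivity) (by positivity)).trans_eq ?_
        rw [← Real.rpow_add two_pos, ← Real.rpow_natCast (Fintype.card ι : ℝ),
          ← Real.rpow_logb two_pos (by norm_num) hD, ← Real.rpow_mul two_pos.le,
          Real.rpow_logb two_pos (by norm_num) hD]
        congr 1
        ring
      have h5 : Fintype.card (Fin n → ι) = Fintype.card ι ^ n := by simp
      rw [h5]
      exact_mod_cast h3
  obtain ⟨N, hN⟩ := exists_noisyOperation (τ := Fin m → Fin 2 × Fin 2) (copies_isometry hV n)
    (copies_isometry' hV' n) 0 (fun x => Finset.prod_nonneg fun k _ => ha0 (x k))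
    (sum_prod_eq_one ha n) T hcard
  refine ⟨N, ?_⟩
  rw [copies_conj, purePairs_eq]
  refine hN.trans_eq ?_
  congr 1
  -- Removing the strings of zero probability from the typical set does not change the mass of the
  -- complement.
  refine (Finset.sum_subset (Finset.compl_subset_compl.mpr (Finset.filter_subset _ _)) ?_).symm
  intro x hx hx'
  rw [Finset.mem_compl, not_not] at hx'
  rw [Finset.mem_compl, Finset.mem_filter, not_and_not_right] at hx
  exact hx hx'

omit [DecidableEq ι] in
lemma IsState.nonempty {σ : Matrix ι ι ℂ} (hσ : IsState σ) : Nonempty ι := by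
  by_contra h
  rw [not_nonempty_iff] at h
  have := hσ.trace_eq_one
  simp [Matrix.trace] at this

lemma extractionRate_le {σ : Matrix ι ι ℂ} (hσ : IsState σ) :
    extractionRate σ ≤ ((Real.logb 2 (Fintype.card ι) - entropy σ : ℝ) : EReal) := by
  have := hσ.nonempty
  obtain ⟨V, a, hV, hV', hσV, ha0, ha⟩ := hσ.exists_diagonalization
  have hS : ∑ i, a i * -Real.logb 2 (a i) = entropy σ := by
    rw [entropy_eq hV hσV, ← Finset.sum_neg_distrib]
    exact Finset.sum_congr rfl fun i _ => by ring
  refine sSup_le ?_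
  rintro R ⟨m, N, hN, rfl⟩
  refine EReal.le_of_forall_lt_iff_le.mp fun z hz => ?_
  rw [EReal.coe_lt_coe_iff] at hz
  set δ := (z - (Real.logb 2 (Fintype.card ι) - entropy σ)) / 2 with hδ
  have hδ0 : 0 < δ := by rw [hδ]; linarith
  have h1 := tendsto_sum_not_typical ha0 ha _ hS hδ0
  refine limsup_le_of_le (h := ?_)
  -- With both errors below 1/4 the power of two exceeds 1/2, so its exponent exceeds -1. The excess
  -- 1 is at most `n * δ`, which is the second `δ` in `z`.
  filter_upwards [hN.eventually_lt_const (show (0 : ℝ) < 1 / 4 by norm_num),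
    h1.eventually_lt_const (show (0 : ℝ) < 1 / 4 by norm_num), eventually_gt_atTop 0,
    (tendsto_natCast_atTop_atTop (R := ℝ)).eventually_ge_atTop (1 / δ)] with n hn1 hn2 hn3 hn4
  have hn : (0 : ℝ) < n := by exact_mod_cast hn3
  rw [EReal.coe_le_coe_iff, div_le_iff₀ hn]
  have h2 := one_sub_traceNorm_le hV hV' ha0 (entropy σ) δ (N n)
  rw [← hσV] at h2
  have h3 : (2 : ℝ) ^ (-1 : ℝ) <
      (2 : ℝ) ^ (n * (Real.logb 2 (Fintype.card ι) - entropy σ + δ) - 2 * m n) := by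
    rw [Real.rpow_neg_one]
    linarith
  rw [Real.rpow_lt_rpow_left_iff (by norm_num)] at h3
  rw [div_le_iff₀ hδ0] at hn4
  have h5 : z = Real.logb 2 (Fintype.card ι) - entropy σ + 2 * δ := by rw [hδ]; ring
  rw [h5]
  nlinarith

lemma le_extractionRate {σ : Matrix ι ι ℂ} (hσ : IsState σ) :
    ((Real.logb 2 (Fintype.card ι) - entropy σ : ℝ) : EReal) ≤ extractionRate σ := by
  have := hσ.nonempty
  obtain ⟨V, a, hV, hV', hσV, ha0, ha⟩ := hσ.exists_diagonalization
  have hS : ∑ i, a i * -Real.logb 2 (a i) = entropy σ := by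
    rw [entropy_eq hV hσV, ← Finset.sum_neg_distrib]
    exact Finset.sum_congr rfl fun i _ => by ring
  refine EReal.ge_of_forall_gt_iff_ge.mp fun z hz => ?_
  rw [EReal.coe_lt_coe_iff] at hz
  set δ := (Real.logb 2 (Fintype.card ι) - entropy σ - z) / 2 with hδ
  have hδ0 : 0 < δ := by rw [hδ]; linarith
  set r := Real.logb 2 (Fintype.card ι) - entropy σ - δ with hr
  -- For negative `r` the natural floor is zero, hence the alternative `m n = 0` below.
  set m : ℕ → ℕ := fun n => ⌊n * r / 2⌋₊ with hm
  have hm' : ∀ n, m n = 0 ∨ 2 * (m n : ℝ) ≤ n * r := fun n => by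
    rcases le_or_gt 0 (n * r / 2) with h | h
    · right
      have := Nat.floor_le h
      simp only [hm]
      linarith
    · left
      exact Nat.floor_of_nonpos h.le
  choose N hN using fun n => exists_extraction hV hV' ha0 ha (entropy σ) δ (hm' n)
  have h1 := tendsto_sum_not_typical ha0 ha _ hS hδ0
  refine le_trans ?_ (le_sSup ⟨m, N, ?_, rfl⟩)
  · refine le_limsup_of_frequently_le' (Eventually.frequently ?_)
    -- The floor loses less than one pair, that is two qubits, and `n * δ ≥ 2` covers this.
    filter_upwards [eventually_gt_atTop 0,
      (tendsto_natCast_atTop_atTop (R := ℝ)).eventually_ge_atTop (2 / δ)] with n hn3 hn4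
    have hn : (0 : ℝ) < n := by exact_mod_cast hn3
    rw [EReal.coe_le_coe_iff, le_div_iff₀ hn]
    rw [div_le_iff₀ hδ0] at hn4
    have h2 := Nat.lt_floor_add_one (n * r / 2)
    have h3 : z = r - δ := by rw [hr, hδ]; ring
    simp only [hm]
    rw [h3]
    nlinarith
  · rw [← hσV] at hN
    refine squeeze_zero (fun n => traceNorm_nonneg _) hN ?_
    simpa using h1.const_mul 2

/-- The optimal rate of extraction of pure qubits is `log D - S`. -/
theorem extractionRate_eq {σ : Matrix ι ι ℂ} (hσ : IsState σ) :
    extractionRate σ = ((Real.logb 2 (Fintype.card ι) - entropy σ : ℝ) : EReal) :=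
  le_antisymm (extractionRate_le hσ) (le_extractionRate hσ)

end Extraction

/-! ### The state held by Bob -/

lemma isState_of_diagonalization {ι : Type} [Fintype ι] [DecidableEq ι] {M V : Matrix ι ι ℂ}
    {a : ι → ℝ} (hV : Vᴴ * V = 1) (hM : M = V * Matrix.diagonal (fun i => (a i : ℂ)) * Vᴴ)
    (ha0 : ∀ i, 0 ≤ a i) (ha : ∑ i, a i = 1) : IsState M where
  posSemidef := by
    rw [hM]
    refine Matrix.PosSemidef.mul_mul_conjTranspose_same (Matrix.PosSemidef.diagonal ?_) V
    intro i
    simpa using ha0 i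
  trace_eq_one := by
    rw [hM, Matrix.trace_mul_comm, ← Matrix.mul_assoc, hV, Matrix.one_mul, Matrix.trace_diagonal]
    exact_mod_cast ha

section Protocol

variable {d : ℕ}

lemma onA_mul (X Y : Matrix (Fin d) (Fin d) ℂ) : onA X * onA Y = onA (X * Y) := by
  rw [onA, onA, onA, ← Matrix.mul_kronecker_mul, Matrix.one_mul]

lemma onA_one : onA (1 : Matrix (Fin d) (Fin d) ℂ) = 1 := Matrix.one_kronecker_one

lemma onA_conjTranspose (X : Matrix (Fin d) (Fin d) ℂ) : (onA X)ᴴ = onA Xᴴ := by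
  rw [onA, onA, Matrix.conjTranspose_kronecker, Matrix.conjTranspose_one]

lemma conjTranspose_mul_unitary (U : Matrix.unitaryGroup (Fin d) ℂ) : U.1ᴴ * U.1 = 1 :=
  Unitary.coe_star_mul_self U

/-- The block of a bipartite matrix belonging to the standard basis vector `i` of Alice. -/
def block (M : Matrix (Fin d × Fin d) (Fin d × Fin d) ℂ) (i : Fin d) : Matrix (Fin d) (Fin d) ℂ :=
  M.submatrix (Prod.mk i) (Prod.mk i)

/-- The block diagonal matrix `∑ i, |i⟩⟨i| ⊗ c i`. -/
def directSum (c : Fin d → Matrix (Fin d) (Fin d) ℂ) : Matrix (Fin d × Fin d) (Fin d × Fin d) ℂ :=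
  (Matrix.blockDiagonal c).submatrix (Equiv.prodComm _ _) (Equiv.prodComm _ _)

lemma directSum_apply (c : Fin d → Matrix (Fin d) (Fin d) ℂ) (p q : Fin d × Fin d) :
    directSum c p q = if p.1 = q.1 then c p.1 p.2 q.2 else 0 := by
  simp [directSum, Matrix.blockDiagonal_apply]

lemma directSum_mul (c c' : Fin d → Matrix (Fin d) (Fin d) ℂ) :
    directSum c * directSum c' = directSum fun i => c i * c' i := by
  rw [directSum, directSum, directSum, Matrix.submatrix_mul_equiv, Matrix.blockDiagonal_mul]

lemma directSum_conjTranspose (c : Fin d → Matrix (Fin d) (Fin d) ℂ) :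
    (directSum c)ᴴ = directSum fun i => (c i)ᴴ := by
  rw [directSum, directSum, Matrix.conjTranspose_submatrix, Matrix.blockDiagonal_conjTranspose]

lemma directSum_diagonal (a : Fin d → Fin d → ℂ) :
    directSum (fun i => Matrix.diagonal (a i)) = Matrix.diagonal fun p => a p.1 p.2 := by
  ext p q
  simp only [directSum_apply, Matrix.diagonal_apply, Prod.ext_iff]
  split_ifs <;> simp_all

lemma directSum_one : directSum (fun _ : Fin d => (1 : Matrix (Fin d) (Fin d) ℂ)) = 1 := by
  simp_rw [← Matrix.diagonal_one]
  exact directSum_diagonal _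

lemma block_directSum (c : Fin d → Matrix (Fin d) (Fin d) ℂ) (i : Fin d) :
    block (directSum c) i = c i := by
  ext x y
  simp [block, directSum_apply]

lemma onA_single_mul_mul (M : Matrix (Fin d × Fin d) (Fin d × Fin d) ℂ) (i : Fin d) :
    onA (Matrix.single i i 1) * M * onA (Matrix.single i i 1) =
      Matrix.single i i 1 ⊗ₖ block M i := by
  ext ⟨a, x⟩ ⟨b, y⟩
  simp only [onA, Matrix.mul_apply, Fintype.sum_prod_type, Matrix.kroneckerMap_apply,
    Matrix.single_apply, Matrix.one_apply, block, Matrix.submatrix_apply]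
  by_cases ha : i = a <;> by_cases hb : i = b <;>
    simp [ha, hb, Finset.sum_ite_eq, Finset.sum_ite_eq', ite_and]

lemma classicalChannel_eq (M : Matrix (Fin d × Fin d) (Fin d × Fin d) ℂ) :
    classicalChannel M = directSum (block M) := by
  ext ⟨a, x⟩ ⟨b, y⟩
  rw [classicalChannel, Finset.sum_congr rfl fun i _ => onA_single_mul_mul M i, Matrix.sum_apply,
    directSum_apply]
  simp [Matrix.single_apply, ite_and]

lemma proj_eq (U : Matrix.unitaryGroup (Fin d) ℂ) (i : Fin d) :
    proj U i = U.1 * Matrix.single i i 1 * U.1ᴴ := by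
  ext a b
  simp [proj, Matrix.vecMulVec_apply, Matrix.mul_apply, Matrix.single_apply, ite_and]

/-- The state `ρ` in the basis in which Alice measures. -/
def rotated (ρ : Matrix (Fin d × Fin d) (Fin d × Fin d) ℂ) (U : Matrix.unitaryGroup (Fin d) ℂ) :
    Matrix (Fin d × Fin d) (Fin d × Fin d) ℂ :=
  onA U.1ᴴ * ρ * onA U.1

lemma onA_proj_mul_mul (ρ : Matrix (Fin d × Fin d) (Fin d × Fin d) ℂ)
    (U : Matrix.unitaryGroup (Fin d) ℂ) (i : Fin d) :
    onA (proj U i) * ρ * onA (proj U i) =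
      onA U.1 * (onA (Matrix.single i i 1) * rotated ρ U * onA (Matrix.single i i 1)) *
        onA U.1ᴴ := by
  simp only [proj_eq, rotated, ← onA_mul, Matrix.mul_assoc]

lemma measureA_eq (ρ : Matrix (Fin d × Fin d) (Fin d × Fin d) ℂ)
    (U : Matrix.unitaryGroup (Fin d) ℂ) :
    measureA U ρ = onA U.1 * directSum (block (rotated ρ U)) * onA U.1ᴴ := by
  rw [← classicalChannel_eq, classicalChannel, Finset.mul_sum, Finset.sum_mul, measureA]
  exact Finset.sum_congr rfl fun i _ => onA_proj_mul_mul ρ U i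

/-- After the rotation the measured state is already block diagonal in the standard basis, so the
dephasing channel leaves it unchanged. -/
lemma protocolState_eq (ρ : Matrix (Fin d × Fin d) (Fin d × Fin d) ℂ)
    (U : Matrix.unitaryGroup (Fin d) ℂ) :
    protocolState ρ U = onA U.1 * directSum (block (rotated ρ U)) * onA U.1ᴴ := by
  have h : onA U.1ᴴ * measureA U ρ * onA U.1 = directSum (block (rotated ρ U)) := by
    rw [measureA_eq]
    simp only [← Matrix.mul_assoc, onA_mul, conjTranspose_mul_unitary, onA_one, Matrix.one_mul]
    rw [Matrix.mul_assoc, onA_mul, conjTranspose_mul_unitary, onA_one, Matrix.mul_one]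
  rw [protocolState, h, classicalChannel_eq]
  congr 3
  exact funext fun i => block_directSum _ i

lemma trace_block (M : Matrix (Fin d × Fin d) (Fin d × Fin d) ℂ) (i : Fin d) :
    (block M i).trace = traceSnd M i i := rfl

lemma traceSnd_onA_mul_mul (M : Matrix (Fin d × Fin d) (Fin d × Fin d) ℂ)
    (X Y : Matrix (Fin d) (Fin d) ℂ) :
    traceSnd (onA X * M * onA Y) = X * traceSnd M * Y := by
  ext i j
  simp only [traceSnd, onA, Matrix.of_apply, Matrix.mul_apply, Fintype.sum_prod_type,
    Matrix.kroneckerMap_apply, Matrix.one_apply, mul_ite, ite_mul, mul_one, mul_zero, zero_mul,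
    Finset.sum_ite_eq, Finset.sum_ite_eq', Finset.mem_univ, if_true, Finset.sum_mul,
    Finset.mul_sum]
  rw [Finset.sum_comm]
  refine Finset.sum_congr rfl fun b _ => ?_
  rw [Finset.sum_comm]

/-- The maximally mixed marginal is invariant under unitary conjugation, so all blocks have equal
weight in every basis. -/
lemma trace_block_rotated {ρ : Matrix (Fin d × Fin d) (Fin d × Fin d) ℂ}
    (hA : traceSnd ρ = (d : ℂ)⁻¹ • (1 : Matrix (Fin d) (Fin d) ℂ))
    (U : Matrix.unitaryGroup (Fin d) ℂ) (i : Fin d) :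
    (block (rotated ρ U) i).trace = (d : ℂ)⁻¹ := by
  rw [trace_block, rotated, traceSnd_onA_mul_mul, hA, Matrix.mul_smul, Matrix.mul_one,
    Matrix.smul_mul, conjTranspose_mul_unitary]
  simp

lemma prob_eq {ρ : Matrix (Fin d × Fin d) (Fin d × Fin d) ℂ}
    (hA : traceSnd ρ = (d : ℂ)⁻¹ • (1 : Matrix (Fin d) (Fin d) ℂ))
    (U : Matrix.unitaryGroup (Fin d) ℂ) (i : Fin d) : prob ρ U i = (d : ℝ)⁻¹ := by
  -- Idempotence and cyclicity of the trace relate the one-sided product in `prob` to the two-sided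
  -- compression.
  have hs : Matrix.single i i (1 : ℂ) = Matrix.single i i 1 * Matrix.single i i 1 := by simp
  have h : (ρ * onA (proj U i)).trace = (block (rotated ρ U) i).trace := by
    have h1 : (Matrix.single i i (1 : ℂ) ⊗ₖ block (rotated ρ U) i).trace =
        (block (rotated ρ U) i).trace := by
      rw [Matrix.trace_kronecker]
      simp
    have h2 : ρ * onA (proj U i) = ρ * onA U.1 * onA (Matrix.single i i 1) * onA U.1ᴴ := by
      simp only [proj_eq, ← onA_mul, Matrix.mul_assoc]
    have h3 : onA U.1ᴴ * (ρ * onA U.1 * onA (Matrix.single i i 1)) =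
        rotated ρ U * onA (Matrix.single i i 1) := by
      simp only [rotated, Matrix.mul_assoc]
    rw [← h1, ← onA_single_mul_mul, Matrix.trace_mul_comm _ (onA (Matrix.single i i 1)),
      ← Matrix.mul_assoc, onA_mul, ← hs, h2, Matrix.trace_mul_comm, h3, Matrix.trace_mul_comm]
  rw [prob, h, trace_block_rotated hA, ← Complex.ofReal_natCast, ← Complex.ofReal_inv,
    Complex.ofReal_re]

/-- The compressed state is a product of `proj U i`, of trace one, with the block; dividing by the
probability 1/d gives the factor `d`. -/
lemma bobState_eq {ρ : Matrix (Fin d × Fin d) (Fin d × Fin d) ℂ}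
    (hA : traceSnd ρ = (d : ℂ)⁻¹ • (1 : Matrix (Fin d) (Fin d) ℂ))
    (U : Matrix.unitaryGroup (Fin d) ℂ) (i : Fin d) :
    bobState ρ U i = (d : ℂ) • block (rotated ρ U) i := by
  have h : onA U.1 * (Matrix.single i i 1 ⊗ₖ block (rotated ρ U) i) * onA U.1ᴴ =
      proj U i ⊗ₖ block (rotated ρ U) i := by
    rw [onA, onA, ← Matrix.mul_kronecker_mul, ← Matrix.mul_kronecker_mul, proj_eq,
      Matrix.one_mul, Matrix.mul_one]
  have htr : (proj U i).trace = 1 := by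
    rw [proj_eq, Matrix.trace_mul_comm, ← Matrix.mul_assoc, conjTranspose_mul_unitary,
      Matrix.one_mul]
    simp
  rw [bobState, prob_eq hA, onA_proj_mul_mul, onA_single_mul_mul, h]
  have h2 : traceFst (proj U i ⊗ₖ block (rotated ρ U) i) = block (rotated ρ U) i := by
    ext x y
    simp only [traceFst, Matrix.of_apply, Matrix.kroneckerMap_apply]
    rw [← Finset.sum_mul]
    exact (congrArg (· * _) htr).trans (one_mul _)
  rw [h2]
  simp

lemma isState_bobState {ρ : Matrix (Fin d × Fin d) (Fin d × Fin d) ℂ} (hρ : IsState ρ)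
    (hA : traceSnd ρ = (d : ℂ)⁻¹ • (1 : Matrix (Fin d) (Fin d) ℂ))
    (U : Matrix.unitaryGroup (Fin d) ℂ) (i : Fin d) : IsState (bobState ρ U i) where
  posSemidef := by
    rw [bobState_eq hA]
    refine Matrix.PosSemidef.smul ?_ (by positivity)
    refine Matrix.PosSemidef.submatrix ?_ _
    rw [rotated, ← onA_conjTranspose]
    exact hρ.posSemidef.conjTranspose_mul_mul_same _
  trace_eq_one := by
    have hd : (d : ℂ) ≠ 0 := by
      have := i.pos
      exact_mod_cast this.ne'
    rw [bobState_eq hA, Matrix.trace_smul, trace_block_rotated hA, smul_eq_mul, mul_inv_cancel₀ hd]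

/-- Bob's final state is diagonalised by diagonalising his conditional states. -/
lemma protocolState_diagonalization {ρ : Matrix (Fin d × Fin d) (Fin d × Fin d) ℂ}
    (hρ : IsState ρ) (hA : traceSnd ρ = (d : ℂ)⁻¹ • (1 : Matrix (Fin d) (Fin d) ℂ))
    (U : Matrix.unitaryGroup (Fin d) ℂ) :
    ∃ (V : Matrix (Fin d × Fin d) (Fin d × Fin d) ℂ) (b : Fin d → Fin d → ℝ), Vᴴ * V = 1 ∧
      protocolState ρ U =
        V * Matrix.diagonal (fun p => ((b p.1 p.2 / d : ℝ) : ℂ)) * Vᴴ ∧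
      (∀ i x, 0 ≤ b i x) ∧ (∀ i, ∑ x, b i x = 1) ∧
      ∀ i, entropy (bobState ρ U i) = -∑ x, b i x * Real.logb 2 (b i x) := by
  choose V b hV hV' hb hb0 hb1 using fun i => (isState_bobState hρ hA U i).exists_diagonalization
  refine ⟨onA U.1 * directSum V, b, ?_, ?_, hb0, hb1, fun i => entropy_eq (hV i) (hb i)⟩
  · rw [Matrix.conjTranspose_mul, Matrix.mul_assoc, ← Matrix.mul_assoc (onA _)ᴴ, onA_conjTranspose,
      onA_mul, conjTranspose_mul_unitary, onA_one, Matrix.one_mul, directSum_conjTranspose,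
      directSum_mul]
    simp_rw [hV]
    exact directSum_one
  · have hblock : block (rotated ρ U) =
        fun i => V i * Matrix.diagonal (fun x => ((b i x / d : ℝ) : ℂ)) * (V i)ᴴ := by
      funext i
      have hd : (d : ℂ) ≠ 0 := by
        have := i.pos
        exact_mod_cast this.ne'
      have h1 : block (rotated ρ U) i = (d : ℂ)⁻¹ • bobState ρ U i := by
        rw [bobState_eq hA, smul_smul, inv_mul_cancel₀ hd, one_smul]
      rw [h1, hb i, ← Matrix.smul_mul, ← Matrix.mul_smul, ← Matrix.diagonal_smul]
      congr 3
      ext x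
      simp [div_eq_inv_mul]
    rw [protocolState_eq, hblock, Matrix.conjTranspose_mul, onA_conjTranspose,
      ← directSum_diagonal (fun i x => ((b i x / d : ℝ) : ℂ)), directSum_conjTranspose]
    simp only [Matrix.mul_assoc]
    congr 1
    simp only [← Matrix.mul_assoc]
    rw [directSum_mul, directSum_mul]

lemma isState_protocolState {ρ : Matrix (Fin d × Fin d) (Fin d × Fin d) ℂ}
    (hρ : IsState ρ) (hA : traceSnd ρ = (d : ℂ)⁻¹ • (1 : Matrix (Fin d) (Fin d) ℂ))
    (U : Matrix.unitaryGroup (Fin d) ℂ) : IsState (protocolState ρ U) := by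
  obtain ⟨V, b, hV, h, hb0, hb1, -⟩ := protocolState_diagonalization hρ hA U
  have hd : (d : ℝ) ≠ 0 := by
    have := hρ.nonempty.some.1.pos
    exact_mod_cast this.ne'
  refine isState_of_diagonalization hV h (fun p => div_nonneg (hb0 _ _) (by positivity)) ?_
  rw [← Finset.sum_div, Fintype.sum_prod_type]
  simp [hb1, hd]

/-- The entropy of Bob's final state. -/
lemma entropy_protocolState {ρ : Matrix (Fin d × Fin d) (Fin d × Fin d) ℂ}
    (hρ : IsState ρ) (hA : traceSnd ρ = (d : ℂ)⁻¹ • (1 : Matrix (Fin d) (Fin d) ℂ))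
    (U : Matrix.unitaryGroup (Fin d) ℂ) :
    entropy (protocolState ρ U) =
      Real.logb 2 d + ∑ i, prob ρ U i * entropy (bobState ρ U i) := by
  obtain ⟨V, b, hV, h, -, hb1, hS⟩ := protocolState_diagonalization hρ hA U
  have hd : (d : ℝ) ≠ 0 := by
    have := hρ.nonempty.some.1.pos
    exact_mod_cast this.ne'
  -- Grouping rule for entropy; a zero eigenvalue is treated apart because `Real.logb_div` needs a
  -- nonzero numerator.
  have hterm : ∀ i x, b i x / d * Real.logb 2 (b i x / d) =
      (d : ℝ)⁻¹ * (b i x * Real.logb 2 (b i x)) - (d : ℝ)⁻¹ * Real.logb 2 d * b i x := fun i x => by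
    by_cases h0 : b i x = 0
    · simp [h0]
    · rw [Real.logb_div h0 hd]
      ring
  have hrow : ∀ i, ∑ x, b i x / d * Real.logb 2 (b i x / d) =
      -(prob ρ U i * entropy (bobState ρ U i)) - (d : ℝ)⁻¹ * Real.logb 2 d := fun i => by
    rw [Finset.sum_congr rfl fun x _ => hterm i x, Finset.sum_sub_distrib, ← Finset.mul_sum,
      ← Finset.mul_sum, hb1, prob_eq hA, hS]
    ring
  rw [entropy_eq hV h, Fintype.sum_prod_type, Finset.sum_congr rfl fun i _ => hrow i,
    Finset.sum_sub_distrib, Finset.sum_neg_distrib, Finset.sum_const, Finset.card_univ,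
    Fintype.card_fin, nsmul_eq_mul, ← mul_assoc, mul_inv_cancel₀ hd]
  ring

lemma protocolRateWith_eq {ρ : Matrix (Fin d × Fin d) (Fin d × Fin d) ℂ}
    (hρ : IsState ρ) (hA : traceSnd ρ = (d : ℂ)⁻¹ • (1 : Matrix (Fin d) (Fin d) ℂ))
    (U : Matrix.unitaryGroup (Fin d) ℂ) :
    protocolRateWith ρ U = ((2 * Real.logb 2 d - entropy (protocolState ρ U) : ℝ) : EReal) := by
  have hd : (d : ℝ) ≠ 0 := by
    have := hρ.nonempty.some.1.pos
    exact_mod_cast this.ne'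
  rw [protocolRateWith, extractionRate_eq (isState_protocolState hρ hA U), Fintype.card_prod,
    Fintype.card_fin, Nat.cast_mul, Real.logb_mul hd hd, two_mul]

/-! ### Existence of an optimal measurement -/

lemma isCompact_unitaryGroup (ι : Type) [Fintype ι] [DecidableEq ι] :
    IsCompact (Matrix.unitaryGroup ι ℂ : Set (Matrix ι ι ℂ)) := by
  have hK : IsCompact (Set.univ.pi fun _ => Set.univ.pi fun _ => Metric.closedBall 0 1 :
      Set (ι → ι → ℂ)) :=
    isCompact_univ_pi fun _ => isCompact_univ_pi fun _ => isCompact_closedBall 0 1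
  have hc : IsClosed {V : Matrix ι ι ℂ | V * star V = 1} :=
    isClosed_eq (continuous_id.mul continuous_star) continuous_const
  have heq : (Matrix.unitaryGroup ι ℂ : Set (Matrix ι ι ℂ)) = {V : Matrix ι ι ℂ | V * star V = 1} :=
    Set.ext fun V => Matrix.mem_unitaryGroup_iff
  refine IsCompact.of_isClosed_subset (X := Matrix ι ι ℂ) hK (heq ▸ hc) fun V hV => ?_
  intro i _ j _
  rw [mem_closedBall_zero_iff]
  exact entry_norm_bound_of_unitary hV i j

lemma continuous_protocolState (ρ : Matrix (Fin d × Fin d) (Fin d × Fin d) ℂ) :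
    Continuous fun U : Matrix.unitaryGroup (Fin d) ℂ => protocolState ρ U := by
  have h1 : Continuous fun U : Matrix.unitaryGroup (Fin d) ℂ => onA U.1 := by
    refine continuous_matrix fun i j => ?_
    exact (continuous_subtype_val.matrix_elem _ _).mul continuous_const
  have h2 : Continuous fun U : Matrix.unitaryGroup (Fin d) ℂ => onA U.1ᴴ := by
    simp_rw [← onA_conjTranspose]
    exact h1.matrix_conjTranspose
  -- In this form `U` enters only through `onA U.1` and `onA U.1ᴴ`; everything else is constant.
  simp_rw [protocolState_eq, ← classicalChannel_eq, rotated, classicalChannel]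
  refine (h1.mul (continuous_finsetSum _ fun k _ => ?_)).mul h2
  exact (continuous_const.mul ((h2.mul continuous_const).mul h1)).mul continuous_const

/-- The entropy of a continuous family of Hermitian matrices on a compact space has a minimum. -/
lemma exists_entropy_le {X ι : Type} [TopologicalSpace X] [CompactSpace X] [Nonempty X] [Fintype ι]
    [DecidableEq ι] {F : X → Matrix ι ι ℂ} (hF : Continuous F) (hh : ∀ x, (F x).IsHermitian) :
    ∃ x, ∀ y, entropy (F x) ≤ entropy (F y) := by
  have : CompactSpace (Matrix.unitaryGroup ι ℂ) :=
    isCompact_iff_compactSpace.mp (isCompact_unitaryGroup ι)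
  let G : X × Matrix.unitaryGroup ι ℂ → Matrix ι ι ℂ := fun p => p.2.1ᴴ * F p.1 * p.2.1
  have hG : Continuous G := by
    have hv : Continuous fun p : X × Matrix.unitaryGroup ι ℂ => p.2.1 :=
      continuous_subtype_val.comp continuous_snd
    exact (hv.matrix_conjTranspose.mul (hF.comp continuous_fst)).mul hv
  -- Continuity of eigenvalues is bypassed by minimising over pairs of a point and a unitary
  -- diagonalising its matrix. On this closed set the entropy is the explicit function `H`,
  -- continuous because x log x is.
  let K : Set (X × Matrix.unitaryGroup ι ℂ) :=
    {p | G p = Matrix.diagonal fun i => ((G p i i).re : ℂ)}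
  let H : X × Matrix.unitaryGroup ι ℂ → ℝ := fun p =>
    -∑ i, (G p i i).re * Real.logb 2 (G p i i).re
  have hre : ∀ i, Continuous fun p => (G p i i).re := fun i =>
    Complex.continuous_re.comp (hG.matrix_elem i i)
  have hK : IsCompact K := by
    refine IsClosed.isCompact (isClosed_eq hG ?_)
    exact Continuous.matrix_diagonal
      (continuous_pi fun i => Complex.continuous_ofReal.comp (hre i))
  have hH : Continuous H := by
    refine (continuous_finsetSum _ fun i _ => ?_).neg
    simp only [Real.logb, ← mul_div_assoc]
    exact (Real.continuous_mul_log.comp (hre i)).div_const _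
  have hKH : ∀ p ∈ K, entropy (F p.1) = H p := by
    intro p hp
    refine entropy_eq (V := p.2.1) (Unitary.coe_star_mul_self p.2) ?_
    rw [← show G p = Matrix.diagonal fun i => ((G p i i).re : ℂ) from hp]
    have h1 : p.2.1 * p.2.1ᴴ = 1 := Unitary.coe_mul_star_self p.2
    simp only [G, ← Matrix.mul_assoc, h1, Matrix.one_mul]
    rw [Matrix.mul_assoc, h1, Matrix.mul_one]
  have hex : ∀ x, ∃ V, (x, V) ∈ K := by
    intro x
    obtain ⟨V, hV, hV', hx⟩ := exists_diagonalization (hh x)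
    have h1 : Vᴴ * F x * V = Matrix.diagonal fun i => ((hh x).eigenvalues i : ℂ) := by
      conv_lhs => rw [hx]
      simp only [← Matrix.mul_assoc, hV, Matrix.one_mul]
      rw [Matrix.mul_assoc, hV, Matrix.mul_one]
    refine ⟨⟨V, Matrix.mem_unitaryGroup_iff.mpr hV'⟩, ?_⟩
    change Vᴴ * F x * V = Matrix.diagonal fun i => (((Vᴴ * F x * V) i i).re : ℂ)
    rw [h1]
    simp
  obtain ⟨V₀, hV₀⟩ := hex (Classical.arbitrary X)
  obtain ⟨p, hp, hmin⟩ := hK.exists_isMinOn ⟨_, hV₀⟩ hH.continuousOn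
  refine ⟨p.1, fun y => ?_⟩
  obtain ⟨V, hV⟩ := hex y
  rw [hKH p hp, hKH _ hV]
  exact hmin hV

end Protocol

end LocalInfo

theorem mainTheorem7 (d : ℕ) (ρ : Matrix (Fin d × Fin d) (Fin d × Fin d) ℂ)
    (hρ : LocalInfo.IsState ρ)
    (hA : LocalInfo.traceSnd ρ = (d : ℂ)⁻¹ • (1 : Matrix (Fin d) (Fin d) ℂ)) :
    (∀ U : Matrix.unitaryGroup (Fin d) ℂ,
      LocalInfo.protocolRateWith ρ U =
          ((2 * Real.logb 2 d - LocalInfo.entropy (LocalInfo.protocolState ρ U) : ℝ) : EReal) ∧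
        2 * Real.logb 2 d - LocalInfo.entropy (LocalInfo.protocolState ρ U) =
          Real.logb 2 d -
            ∑ i, LocalInfo.prob ρ U i * LocalInfo.entropy (LocalInfo.bobState ρ U i)) ∧
    LocalInfo.protocolRate ρ =
      ⨆ U : Matrix.unitaryGroup (Fin d) ℂ,
        ((Real.logb 2 d -
          ∑ i, LocalInfo.prob ρ U i * LocalInfo.entropy (LocalInfo.bobState ρ U i) : ℝ) : EReal) ∧
    ∃ U : Matrix.unitaryGroup (Fin d) ℂ, LocalInfo.protocolRateWith ρ U = LocalInfo.protocolRate ρ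
    := by
  have h1 := LocalInfo.protocolRateWith_eq hρ hA
  have h2 : ∀ U, 2 * Real.logb 2 d - LocalInfo.entropy (LocalInfo.protocolState ρ U) =
      Real.logb 2 d -
        ∑ i, LocalInfo.prob ρ U i * LocalInfo.entropy (LocalInfo.bobState ρ U i) := fun U => by
    rw [LocalInfo.entropy_protocolState hρ hA]
    ring
  refine ⟨fun U => ⟨h1 U, h2 U⟩, ?_, ?_⟩
  · rw [LocalInfo.protocolRate]
    exact iSup_congr fun U => by rw [h1, h2]
  · have : CompactSpace (Matrix.unitaryGroup (Fin d) ℂ) :=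
      isCompact_iff_compactSpace.mp (LocalInfo.isCompact_unitaryGroup (Fin d))
    -- The rate is a constant minus the entropy, so a basis of least entropy is optimal.
    obtain ⟨U, hU⟩ := LocalInfo.exists_entropy_le (LocalInfo.continuous_protocolState ρ)
      fun U => (LocalInfo.isState_protocolState hρ hA U).posSemidef.isHermitian
    refine ⟨U, le_antisymm (le_iSup (LocalInfo.protocolRateWith ρ) U) (iSup_le fun W => ?_)⟩
    rw [h1, h1, EReal.coe_le_coe_iff]
    exact sub_le_sub_left (hU W) _
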